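/- Let $k\ge 1$ be an integer. A *binary structure of type $k$* is a set $E$ (possibly infinite, possibly empty) together with $k$ binary relations $\rho_1,\dots,\rho_k$ on $E$. Such a structure $\mathcal S$ *embeds* in $\mathcal R$, written $\mathcal S\le\mathcal R$, if $\mathcal S$ is isomorphic to a restriction of $\mathcal R$ (an induced substructure). A subset $A\subseteq E$ is an *interval* of $(E,\rho_1,\dots,\rho_k)$ if for all $i$, all $a,a'\in A$ and all $x\in E\setminus A$ one has $x\rho_i a\Leftrightarrow x\rho_i a'$ and $a\rho_i x\Leftrightarrow a'\rho_i x$; the structure is *indecomposable* if its only intervals are $\emptyset$, the singletons and $E$. Let $\Omega_k$ be the set of finite binary structures of type $k$ considered up to isomorphism, ordered by embedding, and let $\mathrm{Ind}(\Omega_k)$ be the set of its indecomposable members. The *age* of a structure $\mathcal R$ is the set $\mathrm{Age}(\mathcal R)\subseteq\Omega_k$ of isomorphism types of its finite restrictions. For $\mathcal C\subseteq\Omega_k$ let $\downarrow\mathcal C$ be the set of all members of $\Omega_k$ that embed in some member of $\mathcal C$. A class $\mathcal C\subseteq\mathrm{Ind}(\Omega_k)$ is *hereditary in $\mathrm{Ind}(\Omega_k)$*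 if it contains every member of $\mathrm{Ind}(\Omega_k)$ that embeds in a member of $\mathcal C$; it is *minimal in $\mathrm{Ind}(\Omega_k)$* if it is hereditary in $\mathrm{Ind}(\Omega_k)$, infinite, and each of its proper subclasses that is hereditary in $\mathrm{Ind}(\Omega_k)$ is finite. A class $\mathcal D\subseteq\Omega_k$ is *hereditary* if $\downarrow\mathcal D=\mathcal D$; a hereditary class $\mathcal D$ is *ind-minimal* if $\mathcal D\cap\mathrm{Ind}(\Omega_k)$ is infinite and $\mathcal D'\cap\mathrm{Ind}(\Omega_k)$ is finite for every hereditary class $\mathcal D'\subsetneq\mathcal D$. **Theorem.** Let $\mathcal C$ be a minimal class in $\mathrm{Ind}(\Omega_k)$. Then 1. $\downarrow\mathcal C$ is well-quasi-ordered by embedding; 2. there is an infinite indecomposable binary structure $\mathcal R$ of type $k$ such that $\mathrm{Age}(\mathcal R)=\downarrow\mathcal C$. Consequently, every ind-minimal class $\mathcal D\subseteq\Omega_k$ is well-quasi-ordered by embedding and is the age of an infinite indecomposable binary structure of type $k$. -/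

import Mathlib

/-- A binary structure of type `k` with domain `V`: a family of `k` binary relations on `V`.
The domain may be finite or infinite, and the empty domain is allowed. -/
structure BinStr (k : ℕ) (V : Type*) where
  rel : Fin k → V → V → Prop

namespace BinStr

variable {k : ℕ} {V W X : Type*}

/-- The restriction (induced substructure) of `R` to a subset `A` of its domain. -/
def restrict (R : BinStr k V) (A : Set V) : BinStr k A where
  rel i x y := R.rel i x y

/-- `R` embeds in `S`: `R` is isomorphic to a restriction of `S`. -/
def Embeds (R : BinStr k V) (S : BinStr k W) : Prop :=
  ∃ f : V ↪ W, ∀ i x y, R.rel i x y ↔ S.rel i (f x) (f y)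

/-- `R` and `S` are isomorphic. -/
def IsIso (R : BinStr k V) (S : BinStr k W) : Prop :=
  ∃ f : V ≃ W, ∀ i x y, R.rel i x y ↔ S.rel i (f x) (f y)

/-- `A` is an interval (module) of `R`: the elements of `A` are related in the same way to each
element outside `A`. -/
def IsInterval (R : BinStr k V) (A : Set V) : Prop :=
  ∀ i, ∀ a ∈ A, ∀ a' ∈ A, ∀ x ∉ A,
    (R.rel i x a ↔ R.rel i x a') ∧ (R.rel i a x ↔ R.rel i a' x)

/-- `R` is indecomposable: its only intervals are the trivial ones, that is the empty set,
the singletons and the whole domain. -/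
def Indecomposable (R : BinStr k V) : Prop :=
  ∀ A : Set V, R.IsInterval A → A = ∅ ∨ (∃ x, A = {x}) ∨ A = Set.univ

theorem Embeds.refl (R : BinStr k V) : R.Embeds R :=
  ⟨Function.Embedding.refl V, fun _ _ _ => Iff.rfl⟩

theorem Embeds.trans {R : BinStr k V} {S : BinStr k W} {T : BinStr k X}
    (h : R.Embeds S) (h' : S.Embeds T) : R.Embeds T := by
  obtain ⟨f, hf⟩ := h
  obtain ⟨g, hg⟩ := h'
  exact ⟨f.trans g, fun i x y => (hf i x y).trans (hg i (f x) (f y))⟩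

theorem IsIso.refl (R : BinStr k V) : R.IsIso R :=
  ⟨Equiv.refl V, fun _ _ _ => Iff.rfl⟩

theorem IsIso.symm {R : BinStr k V} {S : BinStr k W} (h : R.IsIso S) : S.IsIso R := by
  obtain ⟨f, hf⟩ := h
  exact ⟨f.symm, fun i x y => by simpa using (hf i (f.symm x) (f.symm y)).symm⟩

theorem IsIso.trans {R : BinStr k V} {S : BinStr k W} {T : BinStr k X}
    (h : R.IsIso S) (h' : S.IsIso T) : R.IsIso T := by
  obtain ⟨f, hf⟩ := h
  obtain ⟨g, hg⟩ := h'
  exact ⟨f.trans g, fun i x y => (hf i x y).trans (hg i (f x) (f y))⟩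

theorem IsIso.embeds {R : BinStr k V} {S : BinStr k W} (h : R.IsIso S) : R.Embeds S := by
  obtain ⟨f, hf⟩ := h
  exact ⟨f.toEmbedding, hf⟩

theorem Embeds.isIso_of_finite [Finite V] [Finite W] {R : BinStr k V} {S : BinStr k W}
    (h : R.Embeds S) (h' : S.Embeds R) : R.IsIso S := by
  obtain ⟨f, hf⟩ := h
  obtain ⟨g, -⟩ := h'
  have hcard : Nat.card V = Nat.card W :=
    le_antisymm (Nat.card_le_card_of_injective f f.injective)
      (Nat.card_le_card_of_injective g g.injective)
  have hb : Function.Bijective f :=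
    (Nat.bijective_iff_injective_and_card f).2 ⟨f.injective, hcard⟩
  exact ⟨Equiv.ofBijective f hb, hf⟩

end BinStr

/-- The finite binary structures of type `k`. -/
structure FinBinStr (k : ℕ) where
  V : Type
  finite : Finite V
  str : BinStr k V

namespace FinBinStr

instance setoid (k : ℕ) : Setoid (FinBinStr k) where
  r R S := R.str.IsIso S.str
  iseqv := ⟨fun R => BinStr.IsIso.refl R.str, fun h => h.symm, fun h h' => h.trans h'⟩

end FinBinStr

/-- `Omega k`: the finite binary structures of type `k`, considered up to isomorphism. -/
def Omega (k : ℕ) : Type 1 := Quotient (FinBinStr.setoid k)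

namespace Omega

variable {k : ℕ}

/-- The isomorphism type of a finite structure. -/
def mk (R : FinBinStr k) : Omega k := Quotient.mk (FinBinStr.setoid k) R

/-- Isomorphism types of finite structures are partially ordered by embedding. -/
instance : PartialOrder (Omega k) where
  le := Quotient.lift₂ (fun R S => R.str.Embeds S.str) (by
    intro R S R' S' hR hS
    exact propext ⟨fun h => (hR.symm.embeds.trans h).trans hS.embeds,
      fun h => (hR.embeds.trans h).trans hS.symm.embeds⟩)
  le_refl := by
    rintro ⟨R⟩
    exact BinStr.Embeds.refl R.str
  le_trans := by
    rintro ⟨R⟩ ⟨S⟩ ⟨T⟩ h h'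
    exact BinStr.Embeds.trans (R := R.str) (S := S.str) (T := T.str) h h'
  le_antisymm := by
    rintro ⟨R⟩ ⟨S⟩ h h'
    have := R.finite
    have := S.finite
    exact Quotient.sound
      (BinStr.Embeds.isIso_of_finite (R := R.str) (S := S.str) h h')

theorem mk_le_mk {R S : FinBinStr k} : mk R ≤ mk S ↔ R.str.Embeds S.str := Iff.rfl

/-- `Ind k`: the class of the indecomposable members of `Omega k`. -/
def Ind (k : ℕ) : Set (Omega k) := mk '' {R | R.str.Indecomposable}

/-- `C` is a hereditary class of indecomposable structures: a class of members of `Ind k` which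
contains every member of `Ind k` that embeds in one of its members. -/
def HereditaryInInd (C : Set (Omega k)) : Prop :=
  C ⊆ Ind k ∧ ∀ R ∈ C, ∀ S ∈ Ind k, S ≤ R → S ∈ C

/-- `C` is a minimal class of `Ind k`: an infinite hereditary class of `Ind k` all of whose proper
subclasses that are hereditary in `Ind k` are finite. -/
def MinimalInInd (C : Set (Omega k)) : Prop :=
  HereditaryInInd C ∧ C.Infinite ∧ ∀ C' : Set (Omega k), HereditaryInInd C' → C' ⊂ C → C'.Finite

/-- `D` is ind-minimal: a hereditary class of finite structures (an initial segment of `Omega k`)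
which contains infinitely many indecomposable structures, while each of its proper hereditary
subclasses contains only finitely many. -/
def IndMinimal (D : Set (Omega k)) : Prop :=
  IsLowerSet D ∧ (D ∩ Ind k).Infinite ∧
    ∀ D' : Set (Omega k), IsLowerSet D' → D' ⊂ D → (D' ∩ Ind k).Finite

end Omega

/-- The age of `R`: the isomorphism types of its finite restrictions. -/
def BinStr.age {k : ℕ} {V : Type} (R : BinStr k V) : Set (Omega k) :=
  {T | ∃ (A : Set V) (hA : A.Finite), T = Omega.mk ⟨A, hA.to_subtype, R.restrict A⟩}

open Set

/-! ### Congruences, quotients and lexicographic sums -/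

namespace BinStr

variable {k : ℕ} {V W : Type*}

/-! The engine is `isPWO_of_finite_inter_ind`: a hereditary class with finitely many indecomposables
is well-quasi-ordered. A decomposable finite structure is a lexicographic sum, over an
indecomposable quotient, of strictly smaller components (`mem_ind_or_exists_isSum`). In a minimal
bad sequence, the structures strictly below some term form a well-quasi-order, so Dickson's lemma
handles the sums over each of the finitely many quotients.

Given a bad sequence in the down-closure of a minimal class, all terms after the first avoid the
first. The structures avoiding it form a hereditary class whose indecomposables are, by minimality,
finite in number; the engine then gives a contradiction.

For the age, minimality leaves only finitely many members of the class not above a given one, so a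
strictly increasing chain exists. Its down-closure contains infinitely many indecomposables, hence
by minimality the whole class. The union of the chain is infinite, has the required age, and is
indecomposable because a nontrivial interval would already show at a finite stage. An ind-minimal
class is the down-closure of its indecomposables, which form a minimal class. -/

theorem restrict_embeds (R : BinStr k V) (A : Set V) : (R.restrict A).Embeds R :=
  ⟨Function.Embedding.subtype _, fun _ _ _ => Iff.rfl⟩

theorem restrict_range_isIso {R : BinStr k V} {S : BinStr k W} (f : V ↪ W)
    (hf : ∀ i x y, R.rel i x y ↔ S.rel i (f x) (f y)) : R.IsIso (S.restrict (range f)) :=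
  ⟨Equiv.ofInjective f f.injective, hf⟩

theorem Indecomposable.of_isIso {R : BinStr k V} {S : BinStr k W} (h : R.IsIso S)
    (hR : R.Indecomposable) : S.Indecomposable := by
  obtain ⟨f, hf⟩ := h
  intro A hA
  have hA' : R.IsInterval (f ⁻¹' A) := by
    intro i a ha a' ha' x hx
    have := hA i (f a) ha (f a') ha' (f x) hx
    rwa [hf, hf, hf, hf]
  rcases hR _ hA' with h | ⟨x, hx⟩ | h
  · left
    rw [← f.image_preimage A, h, image_empty]
  · right; left
    exact ⟨f x, by rw [← f.image_preimage A, hx, image_singleton]⟩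
  · right; right
    rw [← f.image_preimage A, h, image_univ, f.surjective.range_eq]

theorem indecomposable_of_subsingleton [Subsingleton V] (R : BinStr k V) : R.Indecomposable := by
  intro A _
  rcases A.eq_empty_or_nonempty with h | ⟨x, hx⟩
  · exact .inl h
  · exact .inr (.inr (eq_univ_of_forall fun y => Subsingleton.elim x y ▸ hx))

/-- The equivalence relation `s` is a congruence of `R` if its classes are intervals. -/
def IsCongruence (R : BinStr k V) (s : Setoid V) : Prop :=
  ∀ i x x' y, s x x' → ¬ s x y → (R.rel i x y ↔ R.rel i x' y) ∧ (R.rel i y x ↔ R.rel i y x')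

theorem isCongruence_bot (R : BinStr k V) : R.IsCongruence ⊥ := by
  rintro i x x' y (rfl : x = x') -
  exact ⟨Iff.rfl, Iff.rfl⟩

/-- A representative system of the classes of `s`, with the relations induced by `R`. -/
noncomputable def quotient (R : BinStr k V) (s : Setoid V) : BinStr k (Quotient s) where
  rel i a b := R.rel i a.out b.out

/-- Representatives are exchanged one at a time. Inequivalence is needed: relations inside a class,
loops included, depend on the chosen representatives. -/
theorem IsCongruence.quotient_rel {R : BinStr k V} {s : Setoid V} (hs : R.IsCongruence s)
    (i : Fin k) {x y : V} (h : ¬ s x y) :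
    (R.quotient s).rel i (Quotient.mk s x) (Quotient.mk s y) ↔ R.rel i x y := by
  have hx : s (Quotient.mk s x).out x := Quotient.mk_out x
  have hy : s (Quotient.mk s y).out y := Quotient.mk_out y
  have h1 : ¬ s (Quotient.mk s x).out (Quotient.mk s y).out := fun h' =>
    h (s.trans (s.symm hx) (s.trans h' hy))
  have h2 : ¬ s (Quotient.mk s y).out x := fun h' => h (s.trans (s.symm h') hy)
  exact ((hs i _ _ _ hx h1).1).trans (hs i _ _ _ hy h2).2

theorem quotient_embeds (R : BinStr k V) (s : Setoid V) : (R.quotient s).Embeds R :=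
  ⟨⟨Quotient.out, Quotient.out_injective⟩, fun _ _ _ => Iff.rfl⟩

/-- The equivalence relation obtained from `s` by merging the classes that belong to `A`. -/
def mergeClasses (s : Setoid V) (A : Set (Quotient s)) : Setoid V where
  r x y := s x y ∨ (Quotient.mk s x ∈ A ∧ Quotient.mk s y ∈ A)
  iseqv :=
    { refl := fun x => .inl (s.refl x)
      symm := by
        rintro x y (h | h)
        exacts [.inl (s.symm h), .inr h.symm]
      trans := by
        rintro x y z (h | h) (h' | h')
        · exact .inl (s.trans h h')
        · exact .inr ⟨by rw [Quotient.sound (s := s) h]; exact h'.1, h'.2⟩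
        · exact .inr ⟨h.1, by rw [← Quotient.sound (s := s) h']; exact h.2⟩
        · exact .inr ⟨h.1, h'.2⟩ }

theorem IsCongruence.mergeClasses {R : BinStr k V} {s : Setoid V} (hs : R.IsCongruence s)
    {A : Set (Quotient s)} (hA : (R.quotient s).IsInterval A) :
    R.IsCongruence (mergeClasses s A) := by
  rintro i x x' y (h | ⟨hx, hx'⟩) hy
  · exact hs i x x' y h fun h' => hy (.inl h')
  · have hyA : Quotient.mk s y ∉ A := fun h' => hy (.inr ⟨hx, h'⟩)
    have hne : ∀ {z}, Quotient.mk s z ∈ A → ¬ s z y := fun hz h' =>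
      hyA (Quotient.sound (s := s) h' ▸ hz)
    have hne' : ∀ {z}, Quotient.mk s z ∈ A → ¬ s y z := fun hz h' => hne hz (s.symm h')
    have := hA i _ hx _ hx' _ hyA
    rw [hs.quotient_rel i (hne hx), hs.quotient_rel i (hne hx'), hs.quotient_rel i (hne' hx),
      hs.quotient_rel i (hne' hx')] at this
    exact this.symm

/-- Take a maximal congruence other than `⊤`: merging the classes in a nontrivial interval of its
quotient would give a strictly larger one, still not `⊤`. -/
theorem exists_isCongruence_indecomposable [Finite V] [Nontrivial V] (R : BinStr k V) :
    ∃ s : Setoid V, s ≠ ⊤ ∧ R.IsCongruence s ∧ (R.quotient s).Indecomposable := by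
  have : Finite (Setoid V) :=
    Finite.of_injective (fun s : Setoid V => (fun x y => s x y : V → V → Prop))
      fun s t h => Setoid.ext fun x y => iff_of_eq (congrFun (congrFun h x) y)
  have hbot : (⊥ : Setoid V) ≠ ⊤ := fun h => by
    obtain ⟨x, y, hxy⟩ := exists_pair_ne V
    exact hxy (Setoid.eq_top_iff.1 h x y)
  obtain ⟨s, ⟨hs, hsR⟩, hmax⟩ := (toFinite {s : Setoid V | s ≠ ⊤ ∧ R.IsCongruence s}).exists_maximal
    ⟨⊥, hbot, R.isCongruence_bot⟩
  refine ⟨s, hs, hsR, fun A hA => ?_⟩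
  by_contra! hcon
  obtain ⟨hne, hsing, huniv⟩ := hcon
  have hle : s ≤ BinStr.mergeClasses s A := fun {x y} h => .inl h
  have hge : ¬ BinStr.mergeClasses s A ≤ s := by
    intro hge
    obtain ⟨a, ha⟩ := hne
    refine hsing a (eq_singleton_iff_unique_mem.2 ⟨ha, fun b hb => ?_⟩)
    induction a using Quotient.inductionOn with | _ a
    induction b using Quotient.inductionOn with | _ b
    exact Quotient.sound (hge (x := b) (y := a) (.inr ⟨hb, ha⟩))
  refine hge (hmax ⟨fun htop => ?_, hsR.mergeClasses hA⟩ hle)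
  have hall : ∀ x y, BinStr.mergeClasses s A x y := fun x y => htop ▸ trivial
  obtain ⟨a, ha⟩ := hne
  obtain ⟨b, hb⟩ := (ne_univ_iff_exists_notMem A).1 huniv
  induction a using Quotient.inductionOn with | _ a
  induction b using Quotient.inductionOn with | _ b
  rcases hall a b with h | h
  · exact hb (Quotient.sound (s := s) h ▸ ha)
  · exact hb h.2

/-- `R` is a lexicographic sum indexed by `Q` along the projection `p`. -/
def IsSumAlong (R : BinStr k V) (Q : BinStr k W) (p : V → W) : Prop :=
  ∀ i x y, p x ≠ p y → (R.rel i x y ↔ Q.rel i (p x) (p y))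

/-- Embeddings of the fibres glue: relations between distinct fibres are dictated by `Q` on both
sides. -/
theorem IsSumAlong.embeds {V' : Type*} {R : BinStr k V} {R' : BinStr k V'} {Q : BinStr k W}
    {p : V → W} {p' : V' → W} (h : R.IsSumAlong Q p) (h' : R'.IsSumAlong Q p')
    (hle : ∀ a, (R.restrict (p ⁻¹' {a})).Embeds (R'.restrict (p' ⁻¹' {a}))) : R.Embeds R' := by
  choose f hf using hle
  let F : V → V' := fun x => f (p x) ⟨x, rfl⟩
  have hF : ∀ x, p' (F x) = p x := fun x => (f (p x) ⟨x, rfl⟩).2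
  -- Lets two points with equal projections be fed to the same fibre embedding despite the dependent
  -- types.
  have hfib : ∀ {a} {x} (hx : p x = a), F x = f a ⟨x, hx⟩ := by
    rintro a x rfl
    rfl
  refine ⟨⟨F, fun x y hxy => ?_⟩, fun i x y => ?_⟩
  · have hpp : p x = p y := by rw [← hF, hxy, hF]
    rw [hfib rfl, hfib hpp.symm] at hxy
    exact congrArg Subtype.val ((f (p x)).injective (Subtype.ext hxy))
  · change R.rel i x y ↔ R'.rel i (F x) (F y)
    by_cases hpp : p x = p y
    · rw [hfib rfl, hfib hpp.symm]
      exact hf (p x) i ⟨x, rfl⟩ ⟨y, hpp.symm⟩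
    · rw [h i x y hpp, h' i (F x) (F y) (by rwa [hF, hF]), hF, hF]

end BinStr

/-! ### Sum decompositions and well-quasi-ordering of isomorphism types -/

namespace Omega

variable {k : ℕ}

theorem mk_surjective : Function.Surjective (mk : FinBinStr k → Omega k) := Quotient.mk_surjective

/-- A chosen finite structure of the given isomorphism type. -/
noncomputable def rep (q : Omega k) : FinBinStr k := Quotient.out q

@[simp]
theorem mk_rep (q : Omega k) : mk q.rep = q := Quotient.out_eq q

theorem isIso_rep (R : FinBinStr k) : R.str.IsIso (mk R).rep.str :=
  (Quotient.mk_out (s := FinBinStr.setoid k) R).symm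

theorem le_iff {q r : Omega k} : q ≤ r ↔ q.rep.str.Embeds r.rep.str := by
  rw [← mk_le_mk, mk_rep, mk_rep]

theorem mk_mem_ind {R : FinBinStr k} : mk R ∈ Ind k ↔ R.str.Indecomposable := by
  refine ⟨?_, fun h => ⟨R, h, rfl⟩⟩
  rintro ⟨S, hS, h⟩
  exact hS.of_isIso (Quotient.exact h)

/-- The number of elements of a finite structure. -/
noncomputable def card : Omega k → ℕ :=
  Quotient.lift (fun R => Nat.card R.V) fun _ _ ⟨f, _⟩ => Nat.card_congr f

theorem card_mk (R : FinBinStr k) : card (mk R) = Nat.card R.V := rfl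

theorem card_strictMono : StrictMono (card : Omega k → ℕ) := by
  intro q r h
  obtain ⟨R, rfl⟩ := mk_surjective q
  obtain ⟨S, rfl⟩ := mk_surjective r
  have := R.finite
  have := S.finite
  obtain ⟨⟨f, hf⟩, hn⟩ := lt_iff_le_not_ge.1 h
  refine lt_of_le_of_ne (Nat.card_le_card_of_injective f f.injective) fun hcard => hn ?_
  have hb : Function.Bijective f :=
    (Nat.bijective_iff_injective_and_card f).2 ⟨f.injective, hcard⟩
  have hiso : R.str.IsIso S.str := ⟨Equiv.ofBijective f hb, hf⟩
  exact mk_le_mk.2 hiso.symm.embeds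

/-- `x` is a lexicographic sum indexed by `q` with components `c`. -/
def IsSum (q : Omega k) (c : q.rep.V → Omega k) (x : Omega k) : Prop :=
  ∃ (R : FinBinStr k) (p : R.V → q.rep.V) (_ : mk R = x), R.str.IsSumAlong q.rep.str p ∧
    ∀ a, c a = mk ⟨_, haveI := R.finite; inferInstance, R.str.restrict (p ⁻¹' {a})⟩

theorem IsSum.le {q : Omega k} {c c' : q.rep.V → Omega k} {x x' : Omega k} (h : IsSum q c x)
    (h' : IsSum q c' x') (hc : c ≤ c') : x ≤ x' := by
  obtain ⟨R, p, rfl, hp, hR⟩ := h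
  obtain ⟨R', p', rfl, hp', hR'⟩ := h'
  refine mk_le_mk.2 (hp.embeds hp' fun a => ?_)
  have := hc a
  rw [hR, hR'] at this
  exact mk_le_mk.1 this

theorem mem_ind_or_exists_isSum (x : Omega k) :
    x ∈ Ind k ∨ ∃ q ∈ Ind k, q ≤ x ∧ ∃ c, IsSum q c x ∧ ∀ a, c a < x := by
  obtain ⟨R, rfl⟩ := mk_surjective x
  have := R.finite
  rcases subsingleton_or_nontrivial R.V with hR | hR
  · exact .inl (mk_mem_ind.2 R.str.indecomposable_of_subsingleton)
  right
  obtain ⟨s, hs, hsR, hind⟩ := R.str.exists_isCongruence_indecomposable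
  let Q : FinBinStr k := ⟨Quotient s, inferInstance, R.str.quotient s⟩
  obtain ⟨f, hf⟩ := isIso_rep Q
  let p : R.V → (mk Q).rep.V := fun x => f (Quotient.mk s x)
  have hp : ∀ {x y}, p x = p y ↔ s x y := fun {x y} =>
    f.injective.eq_iff.trans Quotient.eq
  refine ⟨mk Q, mk_mem_ind.2 hind, mk_le_mk.2 (R.str.quotient_embeds s), _,
    ⟨R, p, rfl, fun i x y hxy => ?_, fun a => rfl⟩, fun a => ?_⟩
  · rw [← hf]
    exact (hsR.quotient_rel i fun h => hxy (hp.2 h)).symm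
  -- A component as large as the whole structure would be its only class, contradicting `s ≠ ⊤`.
  · refine lt_of_le_of_ne (mk_le_mk.2 (R.str.restrict_embeds _)) fun heq => hs ?_
    have hcard := congrArg card heq
    rw [card_mk, card_mk] at hcard
    have huniv : p ⁻¹' {a} = univ := eq_of_subset_of_ncard_le (subset_univ _)
      (by rw [ncard_univ]; exact hcard.ge) finite_univ
    refine (Setoid.eq_top_iff).2 fun x y => hp.1 ?_
    have h : ∀ z, p z = a := fun z => (huniv ▸ mem_univ z : z ∈ p ⁻¹' {a})
    rw [h, h]

/-- Nash-Williams splicing: let `g` be a bad sequence with `g i < f (N i)`, and choose `j` with `N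
j` least. Then `f 0, …, f (N j - 1), g j, g (j + 1), …` is bad and has smaller rank at position `N
j`. -/
theorem _root_.Set.isPWO_setOf_lt_of_isMinBadSeq {α : Type*} [PartialOrder α] {rk : α → ℕ}
    (hrk : StrictMono rk) {D : Set α} (hD : IsLowerSet D) {f : ℕ → α}
    (hf : PartiallyWellOrderedOn.IsBadSeq (· ≤ ·) D f)
    (hmin : ∀ n, PartiallyWellOrderedOn.IsMinBadSeq (· ≤ ·) rk D n f) :
    {x | ∃ n, x < f n}.IsPWO := by
  refine (PartiallyWellOrderedOn.iff_forall_not_isBadSeq _ _).2 fun g hg => ?_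
  choose N hN using hg.1
  obtain ⟨j, hj⟩ : ∃ j, ∀ i, N j ≤ N i :=
    ⟨Function.argmin N, fun i => Function.argmin_le N i⟩
  refine hmin (N j) (fun n => if n < N j then f n else g (j + (n - N j)))
    (fun m hm => (if_pos hm).symm) ?_ ⟨fun n => ?_, fun m n hmn => ?_⟩
  · simpa using hrk (hN j)
  · dsimp only
    split_ifs
    exacts [hf.1 n, hD (hN _).le (hf.1 _)]
  · dsimp only
    split_ifs with hm hn hn
    · exact hf.2 m n hmn
    -- By the choice of `j`, `m < N j ≤ N i` for the index `i` of the `g`-term, so `f m ≤ g i < f (N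
    -- i)` would contradict badness of `f`.
    · exact fun h => hf.2 m _ (lt_of_lt_of_le hm (hj _)) (h.trans (hN _).le)
    · omega
    · exact hg.2 _ _ (by omega)

theorem isPWO_of_finite_inter_ind {D : Set (Omega k)} (hD : IsLowerSet D)
    (hfin : (D ∩ Ind k).Finite) : D.IsPWO := by
  refine (PartiallyWellOrderedOn.iff_not_exists_isMinBadSeq card).2 ?_
  rintro ⟨f, hf, hmin⟩
  have hP := isPWO_setOf_lt_of_isMinBadSeq card_strictMono hD hf hmin
  set P : Set (Omega k) := {x | ∃ n, x < f n}
  have hsum : ∀ q : Omega k, {x | ∃ c, (∀ a, c a ∈ P) ∧ IsSum q c x}.IsPWO := by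
    intro q
    have := q.rep.finite
    refine partiallyWellOrderedOn_iff_exists_lt.2 fun g hg => ?_
    choose c hc hcg using hg
    -- Dickson's lemma for the component families, indexed by the finite domain of `q`.
    obtain ⟨m, n, hmn, hle⟩ := (IsPWO.pi fun _ : q.rep.V => hP).exists_lt
      (f := c) fun n a _ => hc n a
    exact ⟨m, n, hmn, (hcg m).le (hcg n) hle⟩
  have hall : ((D ∩ Ind k) ∪
      ⋃ q ∈ hfin.toFinset, {x | ∃ c, (∀ a, c a ∈ P) ∧ IsSum q c x}).IsPWO := by
    refine hfin.isPWO.union ?_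
    exact (Finset.isPWO_bUnion _).2 fun q _ => hsum q
  obtain ⟨m, n, hmn, hle⟩ := hall.exists_lt (f := f) fun n => by
    rcases mem_ind_or_exists_isSum (f n) with h | ⟨q, hq, hqn, c, hc, hlt⟩
    · exact .inl ⟨hf.1 n, h⟩
    · refine .inr (mem_iUnion₂.2 ⟨q, hfin.mem_toFinset.2 ⟨hD hqn (hf.1 n), hq⟩, c, ?_, hc⟩)
      exact fun a => ⟨n, hlt a⟩
  exact hf.2 m n hmn hle

/-! ### Minimal and ind-minimal classes -/

theorem HereditaryInInd.lowerClosure_inter_ind {C : Set (Omega k)} (hC : HereditaryInInd C) :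
    (lowerClosure C : Set (Omega k)) ∩ Ind k = C := by
  ext x
  constructor
  · rintro ⟨⟨y, hy, hxy⟩, hx⟩
    exact hC.2 y hy x hx hxy
  · exact fun hx => ⟨subset_lowerClosure hx, hC.1 hx⟩

theorem _root_.IsLowerSet.hereditaryInInd {D : Set (Omega k)} (hD : IsLowerSet D) :
    HereditaryInInd (D ∩ Ind k) :=
  ⟨inter_subset_right, fun _ hR _ hS hle => ⟨hD hle hR.1, hS⟩⟩

/-- The members avoiding `q` form a hereditary subclass of `Ind k`, proper because it misses any
member of `C` above `q`. -/
theorem MinimalInInd.finite_not_le {C : Set (Omega k)} (hC : MinimalInInd C) {q : Omega k}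
    (hq : q ∈ lowerClosure C) : {x ∈ C | ¬ q ≤ x}.Finite := by
  refine hC.2.2 _ ⟨fun x hx => hC.1.1 hx.1, fun R hR S hS hle =>
    ⟨hC.1.2 R hR.1 S hS hle, fun h => hR.2 (h.trans hle)⟩⟩ ?_
  obtain ⟨y, hy, hqy⟩ := hq
  exact (ssubset_iff_of_subset (sep_subset _ _)).2 ⟨y, hy, fun h => h.2 hqy⟩

theorem MinimalInInd.isPWO {C : Set (Omega k)} (hC : MinimalInInd C) :
    (lowerClosure C : Set (Omega k)).IsPWO := by
  refine partiallyWellOrderedOn_iff_exists_lt.2 fun f hf => ?_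
  by_contra! hbad
  have hlow : IsLowerSet {x | x ∈ lowerClosure C ∧ ¬ f 0 ≤ x} := fun x y hyx hx =>
    ⟨(lowerClosure C).lower hyx hx.1, fun h => hx.2 (h.trans hyx)⟩
  have hpwo := isPWO_of_finite_inter_ind hlow ((hC.finite_not_le (hf 0)).subset
    fun x ⟨⟨hx, h⟩, hind⟩ => ⟨hC.1.lowerClosure_inter_ind.subset ⟨hx, hind⟩, h⟩)
  obtain ⟨m, n, hmn, hle⟩ := hpwo.exists_lt (f := fun n => f (n + 1))
    fun n => ⟨hf _, hbad 0 _ n.succ_pos⟩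
  exact hbad _ _ (Nat.succ_lt_succ hmn) hle

theorem MinimalInInd.exists_gt {C : Set (Omega k)} (hC : MinimalInInd C) {q : Omega k}
    (hq : q ∈ C) : ∃ r ∈ C, q < r := by
  obtain ⟨r, hr, hn⟩ := hC.2.1.exists_notMem_finite
    ((hC.finite_not_le (subset_lowerClosure hq)).insert q)
  simp only [mem_insert_iff, mem_ofPred_eq, not_or, not_and, not_not] at hn
  exact ⟨r, hr, lt_of_le_of_ne (hn.2 hr) fun h => hn.1 h.symm⟩

theorem MinimalInInd.exists_strictMono {C : Set (Omega k)} (hC : MinimalInInd C) :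
    ∃ q : ℕ → Omega k, StrictMono q ∧ ∀ n, q n ∈ C := by
  obtain ⟨q₀, hq₀⟩ := hC.2.1.nonempty
  have : Nonempty C := ⟨⟨q₀, hq₀⟩⟩
  have : NoMaxOrder C := ⟨fun q => by
    obtain ⟨r, hr, h⟩ := hC.exists_gt q.2
    exact ⟨⟨r, hr⟩, h⟩⟩
  obtain ⟨f, hf⟩ := Nat.exists_strictMono C
  exact ⟨fun n => f n, fun m n h => hf h, fun n => (f n).2⟩

/-- The indecomposables below the chain form an infinite hereditary subclass of `C`, so by
minimality they exhaust `C`. -/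
theorem MinimalInInd.lowerClosure_range_eq {C : Set (Omega k)} (hC : MinimalInInd C)
    {q : ℕ → Omega k} (hq : StrictMono q) (hqC : ∀ n, q n ∈ C) :
    lowerClosure (range q) = lowerClosure C := by
  have hsub : (lowerClosure (range q) : Set (Omega k)) ∩ Ind k ⊆ C := by
    rintro x ⟨⟨_, ⟨n, rfl⟩, hx⟩, hind⟩
    exact hC.1.2 _ (hqC n) x hind hx
  have hrange : range q ⊆ (lowerClosure (range q) : Set (Omega k)) ∩ Ind k := by
    rintro _ ⟨n, rfl⟩
    exact ⟨subset_lowerClosure ⟨n, rfl⟩, hC.1.1 (hqC n)⟩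
  have heq : (lowerClosure (range q) : Set (Omega k)) ∩ Ind k = C := by
    by_contra hne
    exact ((infinite_range_of_injective hq.injective).mono hrange)
      (hC.2.2 _ (lowerClosure (range q)).lower.hereditaryInInd (hsub.ssubset_of_ne hne))
  refine le_antisymm (lowerClosure_mono (range_subset_iff.2 hqC)) (lowerClosure_le.2 ?_)
  exact fun x hx => (heq.superset hx).1

/-- A hereditary class is recovered in `Ind k` from its down-closure, so a proper subclass has a
proper down-closure in `D`. -/
theorem IndMinimal.minimalInInd {D : Set (Omega k)} (hD : IndMinimal D) :
    MinimalInInd (D ∩ Ind k) := by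
  refine ⟨hD.1.hereditaryInInd, hD.2.1, fun C hC hlt => ?_⟩
  have hsub : (lowerClosure C : Set (Omega k)) ⊆ D :=
    lowerClosure_min (hlt.subset.trans inter_subset_left) hD.1
  rw [← hC.lowerClosure_inter_ind]
  refine hD.2.2 _ (lowerClosure C).lower (hsub.ssubset_of_ne fun h => hlt.ne ?_)
  rw [← h, hC.lowerClosure_inter_ind]

/-- This down-closure has the same infinitely many indecomposables as `D`, so it cannot be a proper
subclass. -/
theorem IndMinimal.lowerClosure_inter_ind {D : Set (Omega k)} (hD : IndMinimal D) :
    (lowerClosure (D ∩ Ind k) : Set (Omega k)) = D := by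
  by_contra hne
  have hfin := hD.2.2 _ (lowerClosure (D ∩ Ind k)).lower
    ((lowerClosure_min inter_subset_left hD.1).ssubset_of_ne hne)
  rw [hD.1.hereditaryInInd.lowerClosure_inter_ind] at hfin
  exact hD.2.1 hfin

end Omega

/-! ### Unions of increasing sequences of finite structures -/

namespace BinStr

variable {k : ℕ} {V : Type}

/-- The embeddings `e n` exhibit `R` as the union of the increasing sequence `T`. -/
structure IsUnion (R : BinStr k V) (T : ℕ → FinBinStr k) (e : ∀ n, (T n).V ↪ V) : Prop where
  rel_iff : ∀ n i x y, (T n).str.rel i x y ↔ R.rel i (e n x) (e n y)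
  mono : Monotone fun n => range (e n)
  exists_mem : ∀ v, ∃ n, v ∈ range (e n)

theorem exists_isUnion (T : ℕ → FinBinStr k) (h : ∀ n, (T n).str.Embeds (T (n + 1)).str) :
    ∃ (V : Type) (R : BinStr k V) (e : ∀ n, (T n).V ↪ V), R.IsUnion T e := by
  choose g hg using h
  -- Compositions of the one-step embeddings form a directed system; its direct limit is the union.
  let f : ∀ m n : ℕ, m ≤ n → ((T m).V ↪ (T n).V) := fun m n hmn =>
    Nat.leRecOn (C := fun j => (T m).V ↪ (T j).V) hmn (fun {j} e => e.trans (g j))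
      (Function.Embedding.refl _)
  have f_self : ∀ m x, f m m le_rfl x = x := fun m x => by
    simp only [f, Nat.leRecOn_self]
    rfl
  have f_succ : ∀ m n (hmn : m ≤ n) x, f m (n + 1) (hmn.trans n.le_succ) x = g n (f m n hmn x) := by
    intro m n hmn x
    simp only [f, Nat.leRecOn_succ hmn]
    rfl
  have f_trans : ∀ l m n (hlm : l ≤ m) (hmn : m ≤ n) x,
      f m n hmn (f l m hlm x) = f l n (hlm.trans hmn) x := by
    intro l m n hlm hmn x
    induction n, hmn using Nat.le_induction with
    | base => exact f_self _ _
    | succ n hmn ih => rw [f_succ m n hmn, ih, f_succ l n (hlm.trans hmn)]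
  have f_rel : ∀ i m n (hmn : m ≤ n) x y,
      (T m).str.rel i x y ↔ (T n).str.rel i (f m n hmn x) (f m n hmn y) := by
    intro i m n hmn x y
    induction n, hmn using Nat.le_induction with
    | base => rw [f_self, f_self]
    | succ n hmn ih => rw [ih, f_succ m n hmn, f_succ m n hmn, ← hg]
  have : DirectedSystem (fun n => (T n).V) (f · · ·) :=
    ⟨fun n x => f_self n x, fun n m l hlm hmn x => f_trans l m n hlm hmn x⟩
  refine ⟨DirectLimit (fun n => (T n).V) f,
    ⟨fun i => DirectLimit.lift₂ f f (fun n x y => (T n).str.rel i x y)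
      fun m n hmn x y => propext (f_rel i m n hmn x y)⟩,
    fun n => ⟨_, DirectLimit.mk_injective f (fun i j hij => (f i j hij).injective) n⟩,
    fun n i x y => ?_, ?_, fun v => ?_⟩
  · simp only [Function.Embedding.coeFn_mk]
    rw [DirectLimit.lift₂_def]
  · rintro m n hmn _ ⟨x, rfl⟩
    exact ⟨f m n hmn x, DirectLimit.mk_apply (f := f) m n x hmn⟩
  · obtain ⟨n, x, rfl⟩ := DirectLimit.exists_eq_mk f v
    exact ⟨n, x, rfl⟩

namespace IsUnion

variable {R : BinStr k V} {T : ℕ → FinBinStr k} {e : ∀ n, (T n).V ↪ V}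

theorem exists_subset_range (h : R.IsUnion T e) {A : Set V} (hA : A.Finite) :
    ∃ n, A ⊆ range (e n) := by
  choose N hN using h.exists_mem
  obtain ⟨n, hn⟩ := (hA.image N).bddAbove
  exact ⟨n, fun v hv => h.mono (hn ⟨v, hv, rfl⟩) (hN v)⟩

theorem age_eq (h : R.IsUnion T e) :
    R.age = {q | q ∈ lowerClosure (range fun n => Omega.mk (T n))} := by
  ext q
  constructor
  · rintro ⟨A, hA, rfl⟩
    obtain ⟨n, hn⟩ := h.exists_subset_range hA
    refine ⟨_, ⟨n, rfl⟩, Omega.mk_le_mk.2 (Embeds.trans ?_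
      (restrict_range_isIso (e n) (h.rel_iff n)).symm.embeds)⟩
    exact ⟨⟨inclusion hn, inclusion_injective hn⟩, fun _ _ _ => Iff.rfl⟩
  · rintro ⟨_, ⟨n, rfl⟩, hq⟩
    obtain ⟨S, rfl⟩ := Omega.mk_surjective q
    obtain ⟨f, hf⟩ := Omega.mk_le_mk.1 hq
    have := S.finite
    exact ⟨range (f.trans (e n)), finite_range _, Quotient.sound
      (restrict_range_isIso (f.trans (e n)) fun i x y => (hf i x y).trans (h.rel_iff n i _ _))⟩

/-- Nontriviality of an interval is witnessed by two points inside and one outside. All three lie in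
one stage, where the trace of the interval is again a nontrivial interval. -/
theorem indecomposable (h : R.IsUnion T e) (hT : ∀ n, (T n).str.Indecomposable) :
    R.Indecomposable := by
  intro A hA
  by_contra! hcon
  obtain ⟨⟨a, ha⟩, hsing, huniv⟩ := hcon
  obtain ⟨b, hb, hba⟩ : ∃ b ∈ A, b ≠ a := by
    by_contra! hb
    exact hsing a (eq_singleton_iff_unique_mem.2 ⟨ha, hb⟩)
  obtain ⟨c, hc⟩ := (ne_univ_iff_exists_notMem A).1 huniv
  obtain ⟨n, hn⟩ := h.exists_subset_range (toFinite {a, b, c})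
  obtain ⟨a, rfl⟩ := hn (by simp : a ∈ _)
  obtain ⟨b, rfl⟩ := hn (by simp : b ∈ _)
  obtain ⟨c, rfl⟩ := hn (by simp : c ∈ _)
  have hint : (T n).str.IsInterval (e n ⁻¹' A) := by
    intro i x hx x' hx' y hy
    have := hA i _ hx _ hx' _ hy
    rwa [h.rel_iff, h.rel_iff, h.rel_iff, h.rel_iff]
  rcases hT n _ hint with h | ⟨x, hx⟩ | h
  · exact (h ▸ ha : a ∈ (∅ : Set (T n).V))
  · have h1 : a = x := (hx ▸ ha : a ∈ ({x} : Set (T n).V))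
    have h2 : b = x := (hx ▸ hb : b ∈ ({x} : Set (T n).V))
    exact hba (by rw [h1, h2])
  · exact hc (h ▸ mem_univ c : c ∈ e n ⁻¹' A)

end IsUnion

end BinStr

/-! ### The infinite indecomposable structure and the main theorem -/

theorem Omega.MinimalInInd.exists_age_eq {k : ℕ} {C : Set (Omega k)} (hC : MinimalInInd C) :
    ∃ (V : Type) (R : BinStr k V),
      Infinite V ∧ R.Indecomposable ∧ R.age = {T : Omega k | T ∈ lowerClosure C} := by
  obtain ⟨q, hq, hqC⟩ := hC.exists_strictMono
  obtain ⟨V, R, e, he⟩ := BinStr.exists_isUnion (fun n => (q n).rep) fun n =>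
    le_iff.1 (hq.monotone n.le_succ)
  refine ⟨V, R, ?_, he.indecomposable fun n => ?_, ?_⟩
  · refine not_finite_iff_infinite.1 fun hfin => ?_
    have hcard : ∀ n, card (q n) ≤ Nat.card V := fun n => by
      rw [← mk_rep (q n), card_mk]
      exact Nat.card_le_card_of_injective _ (e n).injective
    -- Cardinalities increase strictly along the chain, so stage `n` has at least `n` elements; one
    -- more than `Nat.card V` is too many.
    exact absurd ((card_strictMono.comp hq).id_le (Nat.card V + 1))
      (not_le.2 (Nat.lt_succ_of_le (hcard _)))
  · rw [← mk_mem_ind, mk_rep]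
    exact hC.1.1 (hqC n)
  · rw [he.age_eq]
    simp only [mk_rep]
    rw [hC.lowerClosure_range_eq hq hqC]

theorem Set.IsPWO.wellQuasiOrderedLE {α : Type*} [Preorder α] {s : Set α} (hs : s.IsPWO) :
    WellQuasiOrderedLE {x // x ∈ s} :=
  ⟨hs⟩

theorem mainTheorem6 (k : ℕ) (hk : 1 ≤ k) :
    (∀ C : Set (Omega k), Omega.MinimalInInd C →
      WellQuasiOrderedLE {T : Omega k // T ∈ lowerClosure C} ∧
      ∃ (V : Type) (R : BinStr k V),
        Infinite V ∧ R.Indecomposable ∧ R.age = {T : Omega k | T ∈ lowerClosure C}) ∧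
    (∀ D : Set (Omega k), Omega.IndMinimal D →
      WellQuasiOrderedLE {T : Omega k // T ∈ D} ∧
      ∃ (V : Type) (R : BinStr k V),
        Infinite V ∧ R.Indecomposable ∧ R.age = D) := by
  refine ⟨fun C hC => ⟨hC.isPWO.wellQuasiOrderedLE, hC.exists_age_eq⟩, fun D hD => ?_⟩
  have hpwo := hD.minimalInInd.isPWO
  obtain ⟨V, R, hV, hR, hage⟩ := hD.minimalInInd.exists_age_eq
  have heq := hD.lowerClosure_inter_ind
  refine ⟨(heq ▸ hpwo : D.IsPWO).wellQuasiOrderedLE, V, R, hV, hR, hage.trans heq⟩
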